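/- Let $I$ be an infinite set, let $\Delta_\omega\subset[0,1]^I$ be the convex hull of the unit vectors $e_k$ ($k\in I$), and for $\emptyset\ne K\subset I$ let $\Delta_K=\operatorname{co}\{e_k:k\in K\}$, all with the topology of pointwise convergence. For a set $Y$ put $\Delta(Y)=\Delta_\omega\times Y^I$, and for $A\subset Y$ put $\Delta(A)=\{(d,a)\in\Delta(Y): d_i\neq 0\Rightarrow a_i\in A,\ i\in I\}$. For $A\subset Y$ and $W\subset Y\times Y$ put $B(A,W)=\{y:(x,y)\in W\text{ for some }x\in A\}$. Let $Y$ be a uniform space and let $Z$ denote the set $Y$ with a second topology, not necessarily the uniform one. A continuous convexity $\kappa=(Y,C,Z)$ consists of a base $\mathcal B$ of the uniformity made of open entourages and of the smallest possible cardinality, a (possibly empty) family $\mathcal A$ of nonempty subsets of $Y$ (the admissible sets), a function $conv$ assigning to each $A\in\mathcal A$ a nonempty set $conv(A)\subset Y$, a set $Q'\subset\Delta(Y)$ containing $\Delta(B(A,W))$ for all $A\in\mathcal A$, $W\in\mathcal B$, and a multifunction $C:Q'\to Y$ such that (D) for every $a\in Y^I$ and every nonempty finite $K\subset I$ with $\Delta_K\times\{a\}\subset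 Q'$, the map $C(\cdot,a):\Delta_K\to Z$ is single-valued and continuous; (E) for every $U\in\mathcal B$ there is $W\in\mathcal B$ such that $C(\Delta(B(A,W)))\subset B(conv(A),U)$ for all $A\in\mathcal A$. The convexity is global if $Q'=\Delta(Y)$. For a topological space $X$ let $\mathcal F_\kappa(Y,X)$ be the class of all multifunctions $F:Y\to X$ such that for every nonempty finite $K\subset I$, every $a\in Y^I$ and every continuous $f:X\to\Delta_K$, the multifunction $f\circ F\circ C|_{\Delta_K\times\{a\}}:\Delta_K\to\Delta_K$ has a fixed point. **Proposition.** If $\kappa=(Y,C,Z)$ is a continuous global convexity and $X$ is a topological space, then $\mathcal F_\kappa(Y,X)$ contains every continuous function $\psi:Z\to X$ (regarded as the multifunction $y\mapsto\{\psi(y)\}$). -/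

import Mathlib

open Set Topology

universe u v w

namespace SetValuedConvexity

/-- `B(A, W) = ⋃_{x ∈ A} {y | (x, y) ∈ W}`, the `W`-neighbourhood of a set `A`. -/
def nbhd {Y : Type v} (A : Set Y) (W : Set (Y × Y)) : Set Y :=
  {y | ∃ x ∈ A, (x, y) ∈ W}

/-- An open base of the uniformity of `Y`: a family of entourages, open in `Y × Y`, such that
every entourage contains a member of the family. -/
def IsOpenUniformBase (Y : Type v) [UniformSpace Y] (B : Set (Set (Y × Y))) : Prop :=
  (∀ U ∈ B, U ∈ uniformity Y ∧ IsOpen U) ∧ ∀ V ∈ uniformity Y, ∃ U ∈ B, U ⊆ V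

/-- A minimal open base of the uniformity: one of smallest cardinality. -/
def IsMinimalOpenUniformBase (Y : Type v) [UniformSpace Y] (B : Set (Set (Y × Y))) : Prop :=
  IsOpenUniformBase Y B ∧
    ∀ B' : Set (Set (Y × Y)), IsOpenUniformBase Y B' → Cardinal.mk B ≤ Cardinal.mk B'

/-- The unit vector `e_k` of `[0,1]^I`. -/
noncomputable def unitVec {I : Type u} (k : I) : I → ℝ :=
  open scoped Classical in Pi.single k 1

/-- `Δ_K`: the convex hull of the unit vectors `e_k`, `k ∈ K`, with the topology of pointwise
convergence. -/
def face {I : Type u} (K : Set I) : Set (I → ℝ) :=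
  convexHull ℝ (unitVec '' K)

/-- `Δ_ω`: the simplex spanned by all unit vectors. -/
abbrev bigSimplex (I : Type u) : Set (I → ℝ) := face (univ : Set I)

/-- The inclusion of `Δ_K` in `Δ_ω`. -/
def inclFace {I : Type u} {K : Set I} (d : face K) : bigSimplex I :=
  ⟨d, convexHull_mono (image_mono (subset_univ K)) d.2⟩

/-- `Δ(Y) = Δ_ω × Y^ω`, the formal convex combinations of points of `Y`. -/
abbrev FormalComb (I : Type u) (Y : Type v) : Type (max u v) :=
  bigSimplex I × (I → Y)

/-- `Δ(A)`, the formal convex combinations of elements of `A`: the points that carry a nonzero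
coefficient lie in `A`. -/
def formalCombOf (I : Type u) {Y : Type v} (A : Set Y) : Set (FormalComb I Y) :=
  {p | ∀ i, p.1.1 i ≠ 0 → p.2 i ∈ A}

/-- A class of multifunctions between topological spaces. -/
abbrev MultifunctionClass : Type (max (u + 1) (v + 1)) :=
  ∀ (S : Type u) (_ : TopologicalSpace S) (T : Type v) (_ : TopologicalSpace T),
    (S → Set T) → Prop

/-- The class of all single-valued continuous maps. -/
def continuousMaps : MultifunctionClass.{u, v} := fun S _ T _ F =>
  ∃ g : S → T, Continuous g ∧ ∀ s, F s = {g s}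

/-- A convexity `κ = (Y, C, Z)` with respect to a class `V` of multifunctions. Here `Y` is a
uniform space, and `Z` is a topology on `Y` that need not be the uniform one. -/
structure Convexity (I : Type u) (Y : Type v) [UniformSpace Y] (Z : TopologicalSpace Y)
    (V : MultifunctionClass.{u, v}) where
  /-- the fixed minimal open base of the uniformity -/
  base : Set (Set (Y × Y))
  base_minimal : IsMinimalOpenUniformBase Y base
  /-- the admissible sets (there may be none) -/
  admissible : Set (Set Y)
  nonempty_of_admissible : ∀ A ∈ admissible, A.Nonempty
  /-- the convex hull of an admissible set -/
  conv : admissible → Set Y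
  conv_nonempty : ∀ A, (conv A).Nonempty
  /-- the set `Q'` of formal convex combinations at which `C` is defined -/
  domain : Set (FormalComb I Y)
  formalCombOf_subset_domain :
    ∀ A ∈ admissible, ∀ W ∈ base, formalCombOf I (nbhd A W) ⊆ domain
  /-- the convex combination multifunction `C : Q' → Y` -/
  C : domain → Set Y
  /-- condition (D) -/
  C_mem_class : ∀ (a : I → Y) (K : Finset I), K.Nonempty →
    ∀ h : ∀ d : face (K : Set I), (inclFace d, a) ∈ domain,
      V (face (K : Set I)) inferInstance Y Z (fun d => C ⟨(inclFace d, a), h d⟩)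
  /-- condition (E) -/
  C_subset_nbhd_conv : ∀ U ∈ base, ∃ W ∈ base, ∀ A : admissible, ∀ p : domain,
    p.1 ∈ formalCombOf I (nbhd A.1 W) → C p ⊆ nbhd (conv A) U

/-- A continuous convexity: one for the class of all single-valued continuous maps. -/
abbrev ContinuousConvexity (I : Type u) (Y : Type v) [UniformSpace Y]
    (Z : TopologicalSpace Y) : Type (max u v) :=
  Convexity I Y Z continuousMaps.{u, v}

namespace Convexity

variable {I : Type u} {Y : Type v} [UniformSpace Y] {Z : TopologicalSpace Y}
  {V : MultifunctionClass.{u, v}}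

/-- A convexity is global if `C` is defined on all of `Δ(Y)`. -/
def IsGlobal (κ : Convexity I Y Z V) : Prop := κ.domain = univ

/-- The multifunction `f ∘ F ∘ C|_{Δ_K × {a}} : Δ_K → Δ_K`. -/
def composite (κ : Convexity I Y Z V) {Y' : Set Y} {X : Type w} (F : Y' → Set X)
    (K : Set I) (a : I → Y) (f : X → face K) (d : face K) : Set (face K) :=
  {e | ∃ h : (inclFace d, a) ∈ κ.domain, ∃ y : Y', y.1 ∈ κ.C ⟨(inclFace d, a), h⟩ ∧
    ∃ x ∈ F y, f x = e}

/-- The class `𝓕_κ(Y', X)`: the multifunctions `F : Y' → X` such that, for every finite simplex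
`Δ_K`, every `a ∈ (Y')^ω` and every continuous `f : X → Δ_K`, the multifunction
`f ∘ F ∘ C|_{Δ_K × {a}}` has a fixed point. -/
def fixedPointClass (κ : Convexity I Y Z V) (Y' : Set Y) (X : Type w) [TopologicalSpace X] :
    Set (Y' → Set X) :=
  {F | ∀ K : Finset I, K.Nonempty → ∀ a : I → Y, (∀ i, a i ∈ Y') →
    ∀ f : X → face (K : Set I), Continuous f →
      ∃ d : face (K : Set I), d ∈ κ.composite F K a f d}

end Convexity

end SetValuedConvexity

/-! For fixed `a`, condition (D) makes `C(·, a)` a continuous single-valued map of the simplex `Δ_K`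
into `Z`. Composing with `ψ` and `f` gives a continuous self-map of `Δ_K`, so everything rests on
Brouwer's theorem, proved here from Scarf's lemma.

Scarf's lemma (`exists_dominant_image_eq_univ`) is a parity argument. Incidences between dominant
sets of full size and subsets one smaller carrying all colours but `k` are counted twice. A dominant
set that misses a colour contributes an even number; a smaller set contributes 2 or 0, except the
one made of slack points, which contributes 1. So some dominant set has all colours.

For Brouwer, a fine finite subset of the simplex is ranked by coordinates, and `x` gets a colour `i`
with `x i ≤ f x i`. A dominant set of all colours yields clustered points and a lower bound `m` of
mass nearly 1 that `f` almost respects; since total mass is 1, `f x` must be close to `x`. -/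

namespace Scarf

/-! ### Combinatorics of dominant sets and Scarf's lemma. -/

variable {T ι α : Type*} [Fintype T] [DecidableEq T] [Fintype ι] [DecidableEq ι] [LinearOrder α]

/-- A finite set `σ` is dominant for the family of rankings `r` if no point exceeds, in each
ranking, the least element of `σ`. -/
def Dominant (r : ι → T → α) (σ : Finset T) : Prop :=
  ∀ y, ∃ i, ∀ x ∈ σ, r i y ≤ r i x

omit [Fintype T] [DecidableEq T] [Fintype ι] [DecidableEq ι] in
theorem Dominant.mono {r : ι → T → α} {σ τ : Finset T} (h : Dominant r σ) (hτ : τ ⊆ σ) :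
    Dominant r τ := fun y =>
  let ⟨i, hi⟩ := h y
  ⟨i, fun x hx => hi x (hτ hx)⟩

/-- `m` selects, for each ranking, the least element of `τ`. -/
def IsMinSelection (r : ι → T → α) (τ : Finset T) (m : ι → T) : Prop :=
  ∀ i, m i ∈ τ ∧ ∀ x ∈ τ, r i (m i) ≤ r i x

/-- `y` is the greatest, in the ranking `a`, of the points that exceed `m` in all other
rankings. -/
def IsTopAbove (r : ι → T → α) (m : ι → T) (a : ι) (y : T) : Prop :=
  (∀ i, i ≠ a → r i (m i) < r i y) ∧ ∀ z, (∀ i, i ≠ a → r i (m i) < r i z) → r a z ≤ r a y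

omit [Fintype T] [DecidableEq T] [Fintype ι] [DecidableEq ι] in
theorem exists_isMinSelection (r : ι → T → α) {τ : Finset T} (hτ : τ.Nonempty) :
    ∃ m, IsMinSelection r τ m := by
  choose m hm using fun i => τ.exists_min_image (r i) hτ
  exact ⟨m, hm⟩

omit [DecidableEq T] [Fintype ι] [DecidableEq ι] in
theorem exists_isTopAbove (r : ι → T → α) (m : ι → T) (a : ι) {z : T}
    (hz : ∀ i, i ≠ a → r i (m i) < r i z) : ∃ y, IsTopAbove r m a y := by
  classical
  obtain ⟨y, hy, hmax⟩ :=
    (Finset.univ.filter fun z => ∀ i, i ≠ a → r i (m i) < r i z).exists_max_image (r a)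
      ⟨z, by simpa using hz⟩
  exact ⟨y, by simpa using hy, fun z hz => hmax z (by simpa using hz)⟩

-- Dominance tested at `x` itself gives a ranking in which `x` is least in `τ`.
omit [Fintype T] [DecidableEq T] [Fintype ι] [DecidableEq ι] in
theorem Dominant.exists_selection_eq {r : ι → T → α} (hr : ∀ i, Function.Injective (r i))
    {τ : Finset T} (hd : Dominant r τ) {m : ι → T} (hm : IsMinSelection r τ m) {x : T}
    (hx : x ∈ τ) : ∃ i, m i = x := by
  obtain ⟨i, hi⟩ := hd x
  exact ⟨i, hr i (le_antisymm ((hm i).2 x hx) (hi _ (hm i).1))⟩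

omit [Fintype T] in
/-- In a dominant set with one element less than there are rankings, exactly one pair of rankings
shares its least element. -/
theorem Dominant.exists_pair {r : ι → T → α} (hr : ∀ i, Function.Injective (r i))
    {τ : Finset T} (hd : Dominant r τ) (hcard : τ.card + 1 = Fintype.card ι) {m : ι → T}
    (hm : IsMinSelection r τ m) :
    ∃ a b, a ≠ b ∧ m a = m b ∧
      ∀ i j, i ≠ j → m i = m j → i = a ∧ j = b ∨ i = b ∧ j = a := by
  obtain ⟨a, -, b, -, hab, hmab⟩ := Finset.exists_ne_map_eq_of_card_lt_of_maps_to
    (s := Finset.univ) (t := τ) (f := m) (by rw [Finset.card_univ]; omega) (fun i _ => (hm i).1)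
  -- Without `a`, the selection still covers `τ`, now from an index set of the same size, so it is
  -- injective there: every coincidence involves `a`, and by symmetry `b`.
  have key : ∀ a b, a ≠ b → m a = m b → ∀ i j, i ≠ j → m i = m j → i = a ∨ j = a := by
    intro a b hab hmab i j hij hmij
    have himg : (Finset.univ.erase a).image m = τ := by
      ext x
      simp only [Finset.mem_image, Finset.mem_erase, Finset.mem_univ, and_true]
      constructor
      · rintro ⟨i, -, rfl⟩
        exact (hm i).1
      · intro hx
        obtain ⟨i, rfl⟩ := hd.exists_selection_eq hr hm hx
        by_cases hi : i = a
        · exact ⟨b, hab.symm, by rw [hi, hmab]⟩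
        · exact ⟨i, hi, rfl⟩
    have hinj : Set.InjOn m (Finset.univ.erase a : Finset ι) := by
      rw [← Finset.card_image_iff, himg, Finset.card_erase_of_mem (Finset.mem_univ _),
        Finset.card_univ]
      omega
    by_contra! h
    exact hij (hinj (by simpa using h.1) (by simpa using h.2) hmij)
  refine ⟨a, b, hab, hmab, fun i j hij hmij => ?_⟩
  have h1 := key a b hab hmab i j hij hmij
  have h2 := key b a hab.symm hmab.symm i j hij hmij
  grind

omit [Fintype T] [DecidableEq T] [Fintype ι] [DecidableEq ι] in
theorem IsTopAbove.notMem {r : ι → T → α} (hr : ∀ i, Function.Injective (r i))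
    {τ : Finset T} (hd : Dominant r τ) {m : ι → T} (hm : IsMinSelection r τ m) {a b : ι}
    (hab : a ≠ b) (hmab : m a = m b) {y : T} (hy : IsTopAbove r m a y) : y ∉ τ := by
  intro hyτ
  obtain ⟨i, rfl⟩ := hd.exists_selection_eq hr hm hyτ
  by_cases hi : i = a
  · subst hi
    exact lt_irrefl _ (hmab ▸ hy.1 b hab.symm)
  · exact lt_irrefl _ (hy.1 i hi)

-- Dominance of `τ` forces `y` below `m a` in ranking `a`. Adding `y` therefore changes only the
-- least element of that ranking, and maximality of `y` prevents any point from exceeding all the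
-- new least elements.
omit [Fintype T] [Fintype ι] in
theorem IsTopAbove.dominant_insert {r : ι → T → α} {τ : Finset T} (hd : Dominant r τ)
    {m : ι → T} (hm : IsMinSelection r τ m) {a : ι} {y : T} (hy : IsTopAbove r m a y) :
    Dominant r (insert y τ) := by
  have hya : r a y ≤ r a (m a) := by
    obtain ⟨i, hi⟩ := hd y
    by_cases h : i = a
    · exact h ▸ hi _ (hm i).1
    · exact absurd (hi _ (hm i).1) (hy.1 i h).not_ge
  intro z
  by_cases hz : ∀ i, i ≠ a → r i (m i) < r i z
  · refine ⟨a, fun x hx => (hy.2 z hz).trans ?_⟩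
    rcases Finset.mem_insert.1 hx with rfl | hx
    · exact le_rfl
    · exact hya.trans ((hm a).2 x hx)
  · push Not at hz
    obtain ⟨i, hi, hle⟩ := hz
    refine ⟨i, fun x hx => hle.trans ?_⟩
    rcases Finset.mem_insert.1 hx with rfl | hx
    · exact (hy.1 i hi).le
    · exact (hm i).2 x hx

-- The new point takes over as least element in some ranking `j`. The old element `m j` must remain
-- least in another ranking, so `j` belongs to the one pair that shares its least element.
omit [Fintype T] [Fintype ι] [DecidableEq ι] in
theorem Dominant.isTopAbove_of_insert {r : ι → T → α} (hr : ∀ i, Function.Injective (r i))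
    {τ : Finset T} {m : ι → T} (hm : IsMinSelection r τ m) {a b : ι}
    (hpair : ∀ i j, i ≠ j → m i = m j → i = a ∧ j = b ∨ i = b ∧ j = a)
    {y : T} (hyτ : y ∉ τ) (hd : Dominant r (insert y τ)) :
    IsTopAbove r m a y ∨ IsTopAbove r m b y := by
  have hleast : ∀ x ∈ τ, ∃ i, m i = x ∧ r i x < r i y := by
    intro x hx
    obtain ⟨i, hi⟩ := hd x
    refine ⟨i, hr i (le_antisymm ((hm i).2 x hx) (hi _ (Finset.mem_insert_of_mem (hm i).1))),
      lt_of_le_of_ne (hi y (Finset.mem_insert_self _ _)) fun h => hyτ (hr i h ▸ hx)⟩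
  obtain ⟨j, hj⟩ := hd y
  have hlt : ∀ i, i ≠ j → r i (m i) < r i y := by
    intro i hij
    obtain ⟨k, hk, hlt⟩ := hleast (m i) (hm i).1
    by_cases hki : k = i
    · exact hki ▸ hlt
    · obtain ⟨l, hl, hltl⟩ := hleast (m j) (hm j).1
      have hlj : l ≠ j := by
        rintro rfl
        exact (hj _ (Finset.mem_insert_of_mem (hm l).1)).not_gt hltl
      have hkj : k ≠ j := by
        rintro rfl
        exact (hj _ (Finset.mem_insert_of_mem (hm i).1)).not_gt hlt
      have h1 := hpair k i hki hk
      have h2 := hpair l j hlj hl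
      grind
  have htop : IsTopAbove r m j y := by
    refine ⟨hlt, fun z hz => ?_⟩
    obtain ⟨i, hi⟩ := hd z
    by_cases hij : i = j
    · exact hij ▸ hi y (Finset.mem_insert_self _ _)
    · exact absurd (hi _ (Finset.mem_insert_of_mem (hm i).1)) (hz i hij).not_ge
  obtain ⟨l, hl, hltl⟩ := hleast (m j) (hm j).1
  have hlj : l ≠ j := by
    rintro rfl
    exact (hj _ (Finset.mem_insert_of_mem (hm l).1)).not_gt hltl
  rcases hpair l j hlj hl with ⟨-, rfl⟩ | ⟨-, rfl⟩
  · exact Or.inr htop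
  · exact Or.inl htop

open Classical in
/-- A dominant set with one element less than there are rankings, and with an element that is not
a slack point, has exactly two dominant extensions by one point. -/
theorem Dominant.card_extensions {r : ι → T → α} (hr : ∀ i, Function.Injective (r i))
    {s : ι → T} (hs : ∀ i t, r i (s i) ≤ r i t)
    (hs' : ∀ i j t, j ≠ i → t ∉ range s → r i t < r i (s j))
    {τ : Finset T} (hd : Dominant r τ) (hcard : τ.card + 1 = Fintype.card ι)
    {t : T} (ht : t ∈ τ) (hts : t ∉ range s) :
    (Finset.univ.filter fun σ : Finset T =>
      (σ.card = Fintype.card ι ∧ Dominant r σ) ∧ τ ⊆ σ).card = 2 := by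
  obtain ⟨m, hm⟩ := exists_isMinSelection r ⟨t, ht⟩
  obtain ⟨a, b, hab, hmab, hpair⟩ := hd.exists_pair hr hcard hm
  -- The non-slack point `t` lies below `s j` in every ranking but `j`.
  have hms : ∀ i j, m i = s j → i = j := by
    intro i j h
    by_contra hij
    have := hs' i j t (Ne.symm hij) hts
    exact ((hm i).2 t ht).not_gt (h ▸ this)
  -- The slack point `s a` is a candidate for `IsTopAbove`. Equality with `m i` would put `s a` in
  -- `τ`, so `m b = m a = s a`, against `hms`.
  have hslack : ∀ a b, a ≠ b → m a = m b → ∀ i, i ≠ a → r i (m i) < r i (s a) := by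
    intro a b hab hmab i hi
    by_cases h : m i ∈ range s
    · obtain ⟨j, hj⟩ := h
      obtain rfl := hms i j hj.symm
      rw [← hj]
      refine lt_of_le_of_ne (hs _ _) fun h => ?_
      have h' := hr i h
      have hsa : s a ∈ τ := by rw [← h', hj]; exact (hm i).1
      have hma : m a = s a := hr a (le_antisymm ((hm a).2 _ hsa) (hs a _))
      exact hab (hms b a (hmab ▸ hma)).symm
    · exact hs' i a _ hi.symm h
  obtain ⟨y, hy⟩ := exists_isTopAbove r m a (hslack a b hab hmab)
  obtain ⟨z, hz⟩ := exists_isTopAbove r m b (hslack b a hab.symm hmab.symm)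
  have hyτ := hy.notMem hr hd hm hab hmab
  have hzτ := hz.notMem hr hd hm hab.symm hmab.symm
  -- A common point would exceed `m` in every ranking, against dominance of `τ`.
  have hyz : y ≠ z := by
    rintro rfl
    obtain ⟨i, hi⟩ := hd y
    have := hi _ (hm i).1
    by_cases h : i = a
    · exact this.not_gt (hz.1 i (h ▸ hab))
    · exact this.not_gt (hy.1 i h)
  rw [Finset.card_eq_two]
  refine ⟨insert y τ, insert z τ, fun h => ?_, ?_⟩
  · have : y ∈ insert z τ := h ▸ Finset.mem_insert_self y τ
    exact (Finset.mem_insert.1 this).elim hyz hyτ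
  · ext σ
    simp only [Finset.mem_filter, Finset.mem_univ, true_and, Finset.mem_insert,
      Finset.mem_singleton]
    constructor
    · rintro ⟨⟨hσ, hdσ⟩, hsub⟩
      obtain ⟨x, hx, rfl⟩ := Finset.exists_eq_insert_iff.2 ⟨hsub, hcard.trans hσ.symm⟩
      rcases hdσ.isTopAbove_of_insert hr hm hpair hx with h | h
      · left
        rw [hr a (le_antisymm (hy.2 x h.1) (h.2 y hy.1))]
      · right
        rw [hr b (le_antisymm (hz.2 x h.1) (h.2 z hz.1))]
    · rintro (rfl | rfl)
      · exact ⟨⟨by rw [Finset.card_insert_of_notMem hyτ, hcard], hy.dominant_insert hd hm⟩,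
          Finset.subset_insert _ _⟩
      · exact ⟨⟨by rw [Finset.card_insert_of_notMem hzτ, hcard], hz.dominant_insert hd hm⟩,
          Finset.subset_insert _ _⟩

open Classical in
/-- The set of all slack points but one has exactly one dominant extension by one point. -/
theorem card_extensions_slack {r : ι → T → α} (hr : ∀ i, Function.Injective (r i))
    {s : ι → T} (hs : ∀ i t, r i (s i) ≤ r i t)
    (hs' : ∀ i j t, j ≠ i → t ∉ range s → r i t < r i (s j)) (hinj : Function.Injective s)
    (k : ι) {t : T} (hts : t ∉ range s) :
    (Finset.univ.filter fun σ : Finset T =>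
      (σ.card = Fintype.card ι ∧ Dominant r σ) ∧ (Finset.univ.erase k).image s ⊆ σ).card = 1 := by
  have hcard : ((Finset.univ.erase k).image s).card + 1 = Fintype.card ι := by
    rw [Finset.card_image_of_injective _ hinj, Finset.card_erase_of_mem (Finset.mem_univ _),
      Finset.card_univ]
    have : 0 < Fintype.card ι := Fintype.card_pos_iff.2 ⟨k⟩
    omega
  obtain ⟨y, hy, hmax⟩ := (Finset.univ.filter fun t => t ∉ range s).exists_max_image (r k)
    ⟨t, by simpa using hts⟩
  replace hy : y ∉ range s := by simpa using hy
  replace hmax : ∀ z, z ∉ range s → r k z ≤ r k y := fun z hz => hmax z (by simpa using hz)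
  have hout : ∀ z, z ∉ range s → z ∉ (Finset.univ.erase k).image s := by
    intro z hz h
    obtain ⟨i, -, rfl⟩ := Finset.mem_image.1 h
    exact hz ⟨i, rfl⟩
  have hbelow : ∀ z i, z ∉ range s → ¬ r i z ≤ r i (s i) := fun z i hz h =>
    hz ⟨i, hr i (le_antisymm (hs i z) h)⟩
  rw [Finset.card_eq_one]
  refine ⟨insert y ((Finset.univ.erase k).image s), ?_⟩
  ext σ
  simp only [Finset.mem_filter, Finset.mem_univ, true_and, Finset.mem_singleton]
  constructor
  · rintro ⟨⟨hσ, hdσ⟩, hsub⟩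
    obtain ⟨x, hx, rfl⟩ := Finset.exists_eq_insert_iff.2 ⟨hsub, hcard.trans hσ.symm⟩
    obtain ⟨i, hi⟩ := hdσ y
    -- For `i ≠ k` the set contains `s i`, the bottom of ranking `i`, which lies below `y`.
    have hik : i = k := by
      by_contra hik
      refine hbelow y i hy (hi _ (Finset.mem_insert_of_mem (Finset.mem_image_of_mem s ?_)))
      simpa using hik
    subst hik
    have hyx := hi x (Finset.mem_insert_self _ _)
    have hxs : x ∉ range s := by
      rintro ⟨j, rfl⟩
      by_cases hj : j = i
      · exact hbelow y i hy (hj ▸ hyx)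
      · exact hx (Finset.mem_image_of_mem s (by simpa using hj))
    rw [hr i (le_antisymm (hmax x hxs) hyx)]
  · rintro rfl
    refine ⟨⟨by rw [Finset.card_insert_of_notMem (hout y hy), hcard], fun z => ?_⟩,
      Finset.subset_insert _ _⟩
    by_cases hz : z ∈ range s
    · obtain ⟨i, rfl⟩ := hz
      exact ⟨i, fun x _ => hs i x⟩
    · refine ⟨k, fun x hx => ?_⟩
      rcases Finset.mem_insert.1 hx with rfl | hx
      · exact hmax z hz
      · obtain ⟨i, hi, rfl⟩ := Finset.mem_image.1 hx
        exact (hs' k i z (Finset.ne_of_mem_erase hi) hz).le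

open Classical in
/-- A set with as many elements as there are colours, and not of all colours, has an even number
of subsets of one element less that carry precisely the colours other than `k`. -/
theorem even_card_facets (c : T → ι) (k : ι) {σ : Finset T} (hσ : σ.card = Fintype.card ι)
    (hc : σ.image c ≠ Finset.univ) :
    Even (Finset.univ.filter fun τ : Finset T =>
      (τ.card + 1 = Fintype.card ι ∧ τ.image c = Finset.univ.erase k) ∧ τ ⊆ σ).card := by
  rcases (Finset.univ.filter fun τ : Finset T =>
      (τ.card + 1 = Fintype.card ι ∧ τ.image c = Finset.univ.erase k) ∧ τ ⊆ σ).eq_empty_or_nonempty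
    with h | ⟨τ, hτ⟩
  · rw [h]
    simp
  simp only [Finset.mem_filter, Finset.mem_univ, true_and] at hτ
  obtain ⟨⟨hcard, himg⟩, hsub⟩ := hτ
  obtain ⟨y, hy, rfl⟩ := Finset.exists_eq_insert_iff.2 ⟨hsub, hcard.trans hσ.symm⟩
  have hck : ∀ x ∈ τ, c x ≠ k := fun x hx =>
    Finset.ne_of_mem_erase (himg ▸ Finset.mem_image_of_mem c hx)
  have hyk : c y ≠ k := by
    intro h
    refine hc ?_
    rw [Finset.image_insert, himg, h, Finset.insert_erase (Finset.mem_univ _)]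
  have hinj : Set.InjOn c τ := by
    rw [← Finset.card_image_iff, himg, Finset.card_erase_of_mem (Finset.mem_univ _),
      Finset.card_univ]
    omega
  -- The added point repeats the colour of exactly one `x` in `τ`; deleting either of the two gives
  -- the two facets.
  obtain ⟨x, hx, hxy⟩ : ∃ x ∈ τ, c x = c y := by
    rw [← Finset.mem_image, himg]
    simpa using hyk
  have hne : x ≠ y := fun h => hy (h ▸ hx)
  have herase : ((insert y τ).erase x).card + 1 = Fintype.card ι := by
    rw [Finset.card_erase_of_mem (Finset.mem_insert_of_mem hx), hσ]
    omega
  have hτ : τ = (insert y τ).erase y := (Finset.erase_insert hy).symm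
  rw [(?_ : (Finset.univ.filter _) = {τ, (insert y τ).erase x}), Finset.card_pair]
  · exact even_two
  · intro h
    exact Finset.notMem_erase x (insert y τ) (h ▸ hx)
  ext ρ
  simp only [Finset.mem_filter, Finset.mem_univ, true_and, Finset.mem_insert,
    Finset.mem_singleton]
  constructor
  · rintro ⟨⟨hρ, hρimg⟩, hρsub⟩
    obtain ⟨z, hz, hzρ⟩ := Finset.exists_eq_insert_iff.2 ⟨hρsub, hρ.trans hσ.symm⟩
    have hρz : ρ = (insert y τ).erase z := by rw [← hzρ, Finset.erase_insert hz]
    have hzmem : z ∈ insert y τ := hzρ ▸ Finset.mem_insert_self z ρ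
    rcases Finset.mem_insert.1 hzmem with rfl | hzτ
    · exact Or.inl (hρz.trans hτ.symm)
    · right
      have hzc : c z ∈ ρ.image c := by
        rw [hρimg]
        simpa using hck z hzτ
      obtain ⟨v, hv, hvz⟩ := Finset.mem_image.1 hzc
      rw [hρz, Finset.mem_erase, Finset.mem_insert] at hv
      rcases hv with ⟨hvz', rfl | hv⟩
      · rw [hρz, hinj hzτ hx (hvz.symm.trans hxy.symm)]
      · exact absurd (hinj hv hzτ hvz) hvz'
  · rintro (rfl | rfl)
    · exact ⟨⟨hcard, himg⟩, hsub⟩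
    · refine ⟨⟨herase, ?_⟩, Finset.erase_subset _ _⟩
      rw [← himg]
      ext i
      simp only [Finset.mem_image, Finset.mem_erase, Finset.mem_insert]
      constructor
      · rintro ⟨v, ⟨-, rfl | hv⟩, rfl⟩
        · exact ⟨x, hx, hxy⟩
        · exact ⟨v, hv, rfl⟩
      · rintro ⟨v, hv, rfl⟩
        by_cases hvx : v = x
        · exact ⟨y, ⟨hne.symm, Or.inl rfl⟩, by rw [hvx, hxy]⟩
        · exact ⟨v, ⟨hvx, Or.inr hv⟩, rfl⟩

/-- **Scarf's lemma.** -/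
theorem exists_dominant_image_eq_univ {r : ι → T → α} (hr : ∀ i, Function.Injective (r i))
    {s : ι → T} (hs : ∀ i t, r i (s i) ≤ r i t)
    (hs' : ∀ i j t, j ≠ i → t ∉ range s → r i t < r i (s j)) (c : T → ι) (hc : ∀ i, c (s i) = i)
    (k : ι) {t : T} (hts : t ∉ range s) :
    ∃ σ : Finset T, Dominant r σ ∧ σ.image c = Finset.univ := by
  classical
  by_contra! hcon
  have hinj : Function.Injective s := Function.LeftInverse.injective hc
  let R : Finset (Finset T) :=
    Finset.univ.filter fun σ => σ.card = Fintype.card ι ∧ Dominant r σ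
  let D : Finset (Finset T) := Finset.univ.filter fun τ =>
    τ.card + 1 = Fintype.card ι ∧ τ.image c = Finset.univ.erase k
  have hcount := Finset.sum_card_bipartiteAbove_eq_sum_card_bipartiteBelow
    (s := D) (t := R) (fun τ σ => τ ⊆ σ)
  have hright : Even (∑ σ ∈ R, (D.bipartiteBelow (fun τ σ => τ ⊆ σ) σ).card) := by
    refine Finset.even_sum _ fun σ hσ => ?_
    obtain ⟨hσ, hdσ⟩ : σ.card = Fintype.card ι ∧ Dominant r σ := by simpa [R] using hσ
    simpa only [Finset.bipartiteBelow, D, Finset.filter_filter] using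
      even_card_facets c k hσ (hcon σ hdσ)
  have hmem : (Finset.univ.erase k).image s ∈ D := by
    simp only [D, Finset.mem_filter, Finset.mem_univ, true_and]
    constructor
    · rw [Finset.card_image_of_injective _ hinj, Finset.card_erase_of_mem (Finset.mem_univ _),
        Finset.card_univ]
      have : 0 < Fintype.card ι := Fintype.card_pos_iff.2 ⟨k⟩
      omega
    · rw [Finset.image_image, (funext hc : c ∘ s = id), Finset.image_id]
  rw [← Finset.add_sum_erase _ _ hmem] at hcount
  have hone : (R.bipartiteAbove (fun τ σ => τ ⊆ σ) ((Finset.univ.erase k).image s)).card = 1 := by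
    simpa only [Finset.bipartiteAbove, R, Finset.filter_filter] using
      card_extensions_slack hr hs hs' hinj k hts
  have hleft : Even (∑ τ ∈ D.erase ((Finset.univ.erase k).image s),
      (R.bipartiteAbove (fun τ σ => τ ⊆ σ) τ).card) := by
    refine Finset.even_sum _ fun τ hτ => ?_
    rw [Finset.mem_erase] at hτ
    obtain ⟨hne, hτ⟩ := hτ
    obtain ⟨hcard, himg⟩ : τ.card + 1 = Fintype.card ι ∧ τ.image c = Finset.univ.erase k := by
      simpa only [D, Finset.mem_filter, Finset.mem_univ, true_and] using hτ
    -- A set of slack points is determined by its colours, so it would be the exceptional one.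
    obtain ⟨x, hx, hxs⟩ : ∃ x ∈ τ, x ∉ range s := by
      by_contra! hall
      refine hne ?_
      rw [← himg, Finset.image_image]
      refine (Finset.image_id.symm.trans (Finset.image_congr fun x hx => ?_))
      obtain ⟨i, rfl⟩ := hall x hx
      simp [hc]
    by_cases hd : Dominant r τ
    · have := hd.card_extensions hr hs hs' hcard hx hxs
      rw [Finset.bipartiteAbove, Finset.filter_filter, this]
      exact even_two
    · rw [Finset.bipartiteAbove, Finset.filter_filter, Finset.filter_false_of_mem]
      · simp
      · exact fun σ _ h => hd (h.1.2.mono h.2)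
  rw [hone] at hcount
  rw [← hcount] at hright
  exact absurd hleft (by rwa [Nat.even_add, iff_false_left (by decide)] at hright)

end Scarf

/-! ### Scarf's lemma for finite subsets of the simplex. -/

namespace Scarf

variable {ι : Type*} [Fintype ι]

/-- Points of a finite subset of the simplex are ranked by their coordinates, a slack point `i`
comes below all others in the ranking `i` and above them in the other rankings. -/
noncomputable def coordRank (S : Finset (ι → ℝ)) (i : ι) : S ⊕ ι → ℝ ×ₗ ℕ :=
  open scoped Classical in fun t =>
    toLex (Sum.elim (fun x => x.1 i) (fun j => if j = i then -1 else 2) t,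
      (Fintype.equivFin (S ⊕ ι) t : ℕ))

theorem coordRank_injective (S : Finset (ι → ℝ)) (i : ι) :
    Function.Injective (coordRank S i) := by
  intro t t' h
  have := congrArg (fun p => (ofLex p).2) h
  exact (Fintype.equivFin (S ⊕ ι)).injective (Fin.ext this)

/-- In a finite subset `S` of the simplex that is `δ`-dense, with points coloured by the
coordinates, there are a lower bound `m` of nearly full mass and, for each `i` with `m i ≠ 0`, a
point of colour `i` above `m`. -/
theorem exists_mass_bound (S : Finset (ι → ℝ)) (hS : (S : Set (ι → ℝ)) ⊆ stdSimplex ℝ ι)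
    {δ : ℝ} (hδ : 0 < δ) (hdense : ∀ p ∈ stdSimplex ℝ ι, ∃ y ∈ S, ∀ i, |y i - p i| < δ)
    (hne : S.Nonempty) (c : (ι → ℝ) → ι) :
    ∃ m : ι → ℝ, 1 - Fintype.card ι * δ ≤ ∑ i, m i ∧
      ∃ P ⊆ S, P.Nonempty ∧ (∀ x ∈ P, ∀ i, m i ≤ x i) ∧ ∀ i, m i ≠ 0 → ∃ x ∈ P, c x = i := by
  classical
  obtain ⟨t, ht⟩ := hne
  have hrange : ∀ x : S, (Sum.inl x : S ⊕ ι) ∉ range Sum.inr := by simp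
  have hnn : ∀ x ∈ S, ∀ i, 0 ≤ x i := fun x hx => (hS hx).1
  have hle1 : ∀ x ∈ S, ∀ i, x i ≤ 1 := fun x hx i => (mem_Icc_of_mem_stdSimplex (hS hx) i).2
  -- Coordinates lie in `[0, 1]`, so the slack values `-1` and `2` are strictly outside their range
  -- and ties never matter here.
  have hslackle : ∀ (i : ι) (x : S), ¬ coordRank S i (Sum.inl x) ≤ coordRank S i (Sum.inr i) := by
    intro i x
    rw [not_le, Prod.Lex.lt_iff]
    left
    have := hnn x.1 x.2 i
    simp [coordRank]
    linarith
  obtain ⟨σ, hσ, hcol⟩ := exists_dominant_image_eq_univ (coordRank_injective S)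
    (s := Sum.inr) (by
      rintro i (x | j)
      · exact (not_le.1 (hslackle i x)).le
      · rcases eq_or_ne j i with rfl | h
        · exact le_rfl
        · rw [Prod.Lex.le_iff]
          left
          simp [coordRank, h]
          norm_num)
    (by
      rintro i j (x | k) hj hx
      · rw [Prod.Lex.lt_iff]
        left
        have := hle1 x.1 x.2 i
        simp [coordRank, hj]
        linarith
      · exact absurd ⟨k, rfl⟩ hx)
    (Sum.elim (fun x => c x.1) id) (fun i => rfl) (c t) (hrange ⟨t, ht⟩)
  -- the colours of the slack points missing from `σ`
  have hcolour : ∀ i, Sum.inr i ∉ σ → ∃ x : S, Sum.inl x ∈ σ ∧ c x.1 = i := by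
    intro i hi
    have : i ∈ σ.image (Sum.elim (fun x : S => c x.1) id) := hcol ▸ Finset.mem_univ i
    obtain ⟨x | j, hx, hxi⟩ := Finset.mem_image.1 this
    · exact ⟨x, hx, hxi⟩
    · exact absurd (show j = i from hxi) (by rintro rfl; exact hi hx)
  -- A slack point in `σ` is the bottom of its ranking, so that ranking cannot witness dominance at
  -- a point of `S`.
  have hdom : ∀ y : S, ∃ i, Sum.inr i ∉ σ ∧ ∀ x : S, Sum.inl x ∈ σ → y.1 i ≤ x.1 i := by
    intro y
    obtain ⟨i, hi⟩ := hσ (Sum.inl y)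
    refine ⟨i, fun h => hslackle i y (hi _ h), fun x hx => ?_⟩
    have := hi _ hx
    rw [Prod.Lex.le_iff] at this
    rcases this with h | h
    · exact h.le
    · exact h.1.le
  obtain ⟨i₀, hi₀, -⟩ := hdom ⟨t, ht⟩
  let P : Finset (ι → ℝ) := S.filter fun x => ∃ h : x ∈ S, Sum.inl ⟨x, h⟩ ∈ σ
  have hP : ∀ x : S, Sum.inl x ∈ σ → x.1 ∈ P := fun x hx =>
    Finset.mem_filter.2 ⟨x.2, x.2, hx⟩
  have hP' : ∀ x ∈ P, ∃ h : x ∈ S, Sum.inl ⟨x, h⟩ ∈ σ := fun x hx => (Finset.mem_filter.1 hx).2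
  have hPne : P.Nonempty := by
    obtain ⟨x, hx, -⟩ := hcolour i₀ hi₀
    exact ⟨x, hP x hx⟩
  choose z hz hzmin using fun i => P.exists_min_image (fun x => x i) hPne
  let C : Finset ι := Finset.univ.filter fun i => Sum.inr i ∉ σ
  have hiC : ∀ {i}, i ∈ C ↔ Sum.inr i ∉ σ := by simp [C]
  refine ⟨fun i => if i ∈ C then z i i else 0, ?_, P, Finset.filter_subset _ _, hPne,
    fun x hx i => ?_, fun i hi => ?_⟩
  · rw [Finset.sum_ite_mem, Finset.univ_inter]
    by_contra! hlt
    have hCpos : (0 : ℝ) < C.card := by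
      exact_mod_cast Finset.card_pos.2 ⟨i₀, hiC.2 hi₀⟩
    have hCle : (C.card : ℝ) ≤ Fintype.card ι := by exact_mod_cast Finset.card_le_univ C
    set M := ∑ i ∈ C, z i i with hM
    -- If too much mass were missing, spreading it evenly over `C` would raise each minimum by more
    -- than `δ`. A point of `S` within `δ` of the result would then exceed all these minima, against
    -- `hdom`.
    have hshare : δ < (1 - M) / C.card := by
      rw [lt_div_iff₀ hCpos]
      nlinarith
    obtain ⟨y, hyS, hy⟩ := hdense (fun i => if i ∈ C then z i i + (1 - M) / C.card else 0) (by
      constructor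
      · intro i
        dsimp only
        split_ifs
        · have := hnn _ (hP' _ (hz i)).1 i
          linarith
        · exact le_rfl
      · rw [Finset.sum_ite_mem, Finset.univ_inter, Finset.sum_add_distrib, ← hM,
          Finset.sum_const, nsmul_eq_mul]
        field_simp
        ring)
    obtain ⟨i, hi, hmin⟩ := hdom ⟨y, hyS⟩
    obtain ⟨h, hzσ⟩ := hP' _ (hz i)
    have h1 : y i ≤ z i i := hmin ⟨_, h⟩ hzσ
    have h2 := hy i
    rw [if_pos (hiC.2 hi), abs_lt] at h2
    linarith
  · dsimp only
    split_ifs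
    · exact hzmin i x hx
    · exact hnn x (hP' x hx).1 i
  · obtain ⟨x, hx, hxi⟩ := hcolour i (hiC.1 (by by_contra h; exact hi (if_neg h)))
    exact ⟨x, hP x hx, hxi⟩

end Scarf

/-! ### Brouwer's theorem by approximation and compactness. -/

/-- **Brouwer's fixed point theorem** for the standard simplex. -/
theorem stdSimplex.exists_fixedPoint {ι : Type*} [Fintype ι] [Nonempty ι]
    {f : stdSimplex ℝ ι → stdSimplex ℝ ι} (hf : Continuous f) : ∃ x, f x = x := by
  classical
  have hcompact : CompactSpace (stdSimplex ℝ ι) :=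
    isCompact_iff_compactSpace.1 (isCompact_stdSimplex ℝ ι)
  have hnonempty : Nonempty (stdSimplex ℝ ι) :=
    ⟨⟨_, single_mem_stdSimplex ℝ (Classical.arbitrary ι)⟩⟩
  by_contra! hfix
  obtain ⟨x₀, -, hmin⟩ := isCompact_univ.exists_isMinOn (univ_nonempty (α := stdSimplex ℝ ι))
    (f := fun x => dist (f x) x) (hf.dist continuous_id).continuousOn
  have hε : 0 < dist (f x₀) x₀ := dist_pos.2 (hfix x₀)
  set ε := dist (f x₀) x₀
  have hall : ∀ x, ε ≤ dist (f x) x := fun x => hmin (mem_univ x)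
  set n : ℝ := (Fintype.card ι : ℝ) with hn
  have hn0 : 0 < n := by
    rw [hn]
    exact_mod_cast Fintype.card_pos
  -- Chosen so that the final error `n * δ + n * η` is at most `ε / 2`, below the least displacement
  -- `ε`.
  set η := ε / (4 * n) with hη
  have hη0 : 0 < η := by positivity
  obtain ⟨δ', hδ', hunif⟩ := Metric.uniformContinuous_iff.1
    (CompactSpace.uniformContinuous_of_continuous hf) η hη0
  set δ := min η (δ' / (2 * n))
  have hδ0 : 0 < δ := lt_min hη0 (by positivity)
  have hδη : n * δ ≤ ε / 4 := by
    calc n * δ ≤ n * η := by gcongr; exact min_le_left _ _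
      _ = ε / 4 := by rw [hη]; field_simp
  have hnη : n * η = ε / 4 := by rw [hη]; field_simp
  have hδδ' : n * δ < δ' := by
    calc n * δ ≤ n * (δ' / (2 * n)) := by gcongr; exact min_le_right _ _
      _ = δ' / 2 := by field_simp
      _ < δ' := by linarith
  obtain ⟨t, ht, htfin, hcover⟩ := (isCompact_stdSimplex ℝ ι).finite_cover_balls hδ0
  let S := htfin.toFinset
  have hS : (S : Set (ι → ℝ)) ⊆ stdSimplex ℝ ι := by simpa [S] using ht
  have hdense : ∀ p ∈ stdSimplex ℝ ι, ∃ y ∈ S, ∀ i, |y i - p i| < δ := by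
    intro p hp
    obtain ⟨y, hy, hpy⟩ := mem_iUnion₂.1 (hcover hp)
    refine ⟨y, by simpa [S] using hy, fun i => ?_⟩
    rw [← Real.dist_eq, dist_comm]
    exact (dist_le_pi_dist p y i).trans_lt hpy
  have hSne : S.Nonempty := by
    obtain ⟨y, hy, -⟩ := hdense x₀ x₀.2
    exact ⟨y, hy⟩
  have hsum : ∀ x : stdSimplex ℝ ι, ∑ i, x.1 i = 1 := fun x => x.2.2
  have hcolour : ∀ x : stdSimplex ℝ ι, ∃ i, x.1 i ≤ (f x).1 i := by
    intro x
    obtain ⟨i, -, hi⟩ := Finset.exists_le_of_sum_le Finset.univ_nonempty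
      ((hsum x).trans (hsum (f x)).symm).le
    exact ⟨i, hi⟩
  choose c hc using hcolour
  obtain ⟨m, hmass, P, hPS, ⟨x, hx⟩, hPm, hPc⟩ := Scarf.exists_mass_bound S hS hδ0 hdense
    hSne (fun x => if h : x ∈ stdSimplex ℝ ι then c ⟨x, h⟩ else Classical.arbitrary ι)
  -- a point of total mass one above `m - θ` is close to `m`
  have hupper : ∀ (θ : ℝ) (u : stdSimplex ℝ ι), 0 ≤ θ → (∀ i, m i - θ ≤ u.1 i) →
      ∀ i, u.1 i ≤ m i + n * δ + n * θ := by
    intro θ u hθ hu i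
    have h1 : ∑ j ∈ Finset.univ.erase i, (m j - θ) ≤ ∑ j ∈ Finset.univ.erase i, u.1 j :=
      Finset.sum_le_sum fun j _ => hu j
    have h2 := Finset.add_sum_erase Finset.univ (fun j => u.1 j) (Finset.mem_univ i)
    have h3 := Finset.add_sum_erase Finset.univ (fun j => m j - θ) (Finset.mem_univ i)
    rw [Finset.sum_sub_distrib (s := Finset.univ), Finset.sum_const, Finset.card_univ,
      nsmul_eq_mul] at h3
    have h4 := hsum u
    linarith
  have hsimp : ∀ y ∈ P, y ∈ stdSimplex ℝ ι := fun y hy => hS (hPS hy)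
  have hPupper : ∀ y ∈ P, ∀ i, y i ≤ m i + n * δ := by
    intro y hy i
    have := hupper 0 ⟨y, hsimp y hy⟩ le_rfl (by simpa using hPm y hy) i
    simpa using this
  -- All points of `P` lie between `m` and `m + n * δ`, hence within `δ'` of each other.
  have hclose : ∀ y (hy : y ∈ P) i, |(f ⟨y, hsimp y hy⟩).1 i - (f ⟨x, hsimp x hx⟩).1 i| < η := by
    intro y hy i
    have hd : dist (⟨y, hsimp y hy⟩ : stdSimplex ℝ ι) ⟨x, hsimp x hx⟩ < δ' := by
      refine lt_of_le_of_lt ?_ hδδ'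
      rw [Subtype.dist_eq, dist_pi_le_iff (by positivity)]
      intro j
      rw [Real.dist_eq, abs_le]
      have := hPupper y hy j
      have := hPupper x hx j
      have := hPm y hy j
      have := hPm x hx j
      constructor <;> linarith
    rw [← Real.dist_eq]
    exact (dist_le_pi_dist _ _ i).trans_lt (hunif hd)
  have hlower : ∀ i, m i - η ≤ (f ⟨x, hsimp x hx⟩).1 i := by
    intro i
    -- Where `m i = 0` nonnegativity suffices; elsewhere a point of colour `i` in `P` supplies the
    -- bound.
    by_cases hi : m i = 0
    · have := (f ⟨x, hsimp x hx⟩).2.1 i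
      rw [hi]
      linarith
    · obtain ⟨y, hy, hyi⟩ := hPc i hi
      rw [dif_pos (hsimp y hy)] at hyi
      have h1 := hc ⟨y, hsimp y hy⟩
      rw [hyi] at h1
      have h2 := hclose y hy i
      have h3 := hPm y hy i
      rw [abs_lt] at h2
      linarith
  have hfin : dist (f ⟨x, hsimp x hx⟩) ⟨x, hsimp x hx⟩ ≤ ε / 2 := by
    rw [Subtype.dist_eq, dist_pi_le_iff (by positivity)]
    intro i
    have h1 := hupper η _ hη0.le hlower i
    have h2 := hlower i
    have h3 := hPupper x hx i
    have h4 := hPm x hx i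
    have h5 : η ≤ n * η := le_mul_of_one_le_left hη0.le (by
      rw [hn]
      exact_mod_cast Fintype.card_pos (α := ι))
    rw [Real.dist_eq, abs_le]
    constructor <;> linarith
  linarith [hall ⟨x, hsimp x hx⟩]

/-! ### Transfer of Brouwer's theorem to the faces `Δ_K`. -/

namespace SetValuedConvexity

/-- Restriction to `K` maps the face `Δ_K` to the standard simplex on `K`. -/
theorem restrict_mem_stdSimplex {I : Type u} (K : Finset I) {d : I → ℝ}
    (hd : d ∈ face (K : Set I)) :
    (fun k : K => d k) ∈ stdSimplex ℝ K ∧ ∀ i ∉ K, d i = 0 := by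
  classical
  have hconv : Convex ℝ {d : I → ℝ | (fun k : K => d k) ∈ stdSimplex ℝ K ∧ ∀ i ∉ K, d i = 0} := by
    intro x hx y hy a b ha hb hab
    refine ⟨convex_stdSimplex ℝ K hx.1 hy.1 ha hb hab, fun i hi => ?_⟩
    simp [hx.2 i hi, hy.2 i hi]
  refine convexHull_min ?_ hconv hd
  rintro _ ⟨k, hk, rfl⟩
  refine ⟨⟨fun i => ?_, ?_⟩, fun i hi => ?_⟩
  · by_cases h : (i : I) = k <;> simp [unitVec, h]
  · rw [Finset.sum_coe_sort K (fun i => unitVec k i)]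
    simpa [unitVec, Pi.single_apply] using hk
  · have : i ≠ k := fun h => hi (h ▸ hk)
    simp [unitVec, this]

/-- Extension by zero maps the standard simplex on `K` to the face `Δ_K`. -/
theorem extend_mem_face {I : Type u} (K : Finset I) {x : K → ℝ} (hx : x ∈ stdSimplex ℝ K) :
    (∑ k : K, x k • unitVec (k : I)) ∈ face (K : Set I) :=
  (convex_convexHull ℝ _).sum_mem (fun k _ => hx.1 k) hx.2
    fun k _ => subset_convexHull ℝ _ (mem_image_of_mem _ k.2)

theorem sum_smul_unitVec {I : Type u} (K : Finset I) {d : I → ℝ} (hd : ∀ i ∉ K, d i = 0) :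
    (∑ k : K, d k • unitVec (k : I)) = d := by
  classical
  rw [Finset.sum_coe_sort K (fun k => d k • unitVec k)]
  ext i
  by_cases hi : i ∈ K <;> simp [unitVec, Pi.single_apply, Finset.sum_apply, hi, hd]

/-- **Brouwer's fixed point theorem** for the face `Δ_K`. -/
theorem exists_fixedPoint_face {I : Type u} {K : Finset I} (hK : K.Nonempty)
    {g : face (K : Set I) → face (K : Set I)} (hg : Continuous g) : ∃ d, g d = d := by
  let φ : stdSimplex ℝ K → face (K : Set I) := fun x => ⟨_, extend_mem_face K x.2⟩
  let π : face (K : Set I) → stdSimplex ℝ K := fun d => ⟨_, (restrict_mem_stdSimplex K d.2).1⟩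
  have hφ : Continuous φ := by
    refine Continuous.subtype_mk (continuous_finsetSum _ fun k _ => ?_) _
    exact ((continuous_apply k).comp continuous_subtype_val).smul continuous_const
  have hπ : Continuous π := by
    refine Continuous.subtype_mk (continuous_pi fun k => ?_) _
    exact (continuous_apply (k : I)).comp continuous_subtype_val
  have hφπ : ∀ d, φ (π d) = d := fun d =>
    Subtype.ext (sum_smul_unitVec K (restrict_mem_stdSimplex K d.2).2)
  have : Nonempty K := hK.coe_sort
  -- If `x` is fixed by `π ∘ g ∘ φ`, then `g (φ x) = φ (π (g (φ x))) = φ x`.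
  obtain ⟨x, hx⟩ := stdSimplex.exists_fixedPoint (hπ.comp (hg.comp hφ))
  refine ⟨φ x, ?_⟩
  rw [← hφπ (g (φ x))]
  exact congrArg φ hx

end SetValuedConvexity

/-! ### The proposition on continuous global convexities. -/

theorem proposition8p2 {I : Type u} [Infinite I] {Y : Type v} [UniformSpace Y]
    {Z : TopologicalSpace Y} {X : Type w} [TopologicalSpace X]
    (κ : SetValuedConvexity.ContinuousConvexity I Y Z) (hκ : κ.IsGlobal)
    (ψ : Y → X) (hψ : Continuous[Z, _] ψ) :
    (fun y : (univ : Set Y) => ({ψ y.1} : Set X)) ∈ κ.fixedPointClass (univ : Set Y) X := by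
  intro K hK a _ f hf
  have hdom : ∀ p, p ∈ κ.domain := fun p => by
    rw [show κ.domain = univ from hκ]
    exact mem_univ p
  -- Globality puts all of `Δ_K × {a}` in the domain, as condition (D) requires.
  obtain ⟨g, hg, hCg⟩ := κ.C_mem_class a K hK fun d => hdom _
  obtain ⟨d, hd⟩ := SetValuedConvexity.exists_fixedPoint_face hK
    (g := fun d => f (ψ (g d))) (hf.comp (@Continuous.comp _ _ _ _ Z _ _ _ hψ hg))
  refine ⟨d, hdom _, ⟨g d, mem_univ _⟩, ?_, ψ (g d), rfl, hd⟩
  exact (hCg d).ge rfl
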